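/- Let $n, I \ge 0$ be integers and let $k_1,\dots,k_I \ge 1$ be integers with $k_1+\cdots+k_I=n$. Regard the space $M_n(\mathbb{C})$ of complex $n\times n$ matrices as a real Euclidean space of dimension $2n^2$. The real dimension $\dim_{\mathbb R} S$ of a nonempty set $S\subseteq M_n(\mathbb C)$ is the largest $d$ such that $S$ contains a nonempty embedded $C^\infty$ submanifold of $M_n(\mathbb C)$ of dimension $d$; for $S\subseteq N$, the real codimension of $S$ in $N$ is $\dim_{\mathbb R}N-\dim_{\mathbb R}S$. Say that a matrix has multiplicities $(k_1,\dots,k_I)$ if it has exactly $I$ distinct eigenvalues and these, in a suitable order, have algebraic multiplicities $k_1,\dots,k_I$. Let $\mathcal N_n=\{A\in M_n(\mathbb C): AA^*=A^*A\}$, and let $\mathcal N_n(k_1,\dots,k_I)$ be the set of $A \in \mathcal N_n$ with multiplicities $(k_1,\dots,k_I)$. Then: 1. For every diagonal matrix $\Lambda \in M_n(\mathbb C)$ with multiplicities $(k_1,\dots,k_I)$, the unitary orbit $\{U\Lambda U^* : U \in M_n(\mathbb C) \text{ unitary}\}$ is an embedded $C^\infty$ submanifold of $M_n(\mathbb C)$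 of real dimension $$n^2-\sum_{i=1}^I k_i^2 .$$ 2. The set $\mathcal N_n(k_1,\dots,k_I)$ is an embedded $C^\infty$ submanifold of $M_n(\mathbb C)$ of real dimension $$n^2-\sum_{i=1}^I k_i^2+2I .$$ 3. $\dim_{\mathbb R}\mathcal N_n=n^2+n$. 4. The real codimension of $\mathcal N_n(k_1,\dots,k_I)$ in $\mathcal N_n$ is $$n+\sum_{i=1}^I k_i^2-2I=\sum_{i=1}^I (k_i-1)(k_i+2).$$ -/

import Mathlib

/- The space of complex `n × n` matrices is the real Euclidean space of dimension `2 n ^ 2`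
(Frobenius norm). -/
open scoped ContDiff Matrix Matrix.Norms.Frobenius

/-- `S` is an embedded smooth (`C^∞`) submanifold of `E` of real dimension `d`: around each of its
points there is a smooth local diffeomorphism `φ` of `E` that carries `S` onto a piece of a linear
subspace of dimension `d`. -/
def IsSmoothSubmanifold {E : Type*} [NormedAddCommGroup E] [NormedSpace ℝ E]
    [FiniteDimensional ℝ E] (d : ℕ) (S : Set E) : Prop :=
  ∀ x ∈ S, ∃ (φ : OpenPartialHomeomorph E E) (L : Submodule ℝ E),
    x ∈ φ.source ∧ Module.finrank ℝ L = d ∧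
    ContDiffOn ℝ ∞ φ φ.source ∧ ContDiffOn ℝ ∞ φ.symm φ.target ∧
    φ '' (S ∩ φ.source) = (L : Set E) ∩ φ.target

/-- The real dimension of a subset of a finite-dimensional real vector space: the largest `d` such
that the set contains a nonempty embedded smooth submanifold of dimension `d`. For a nonempty
submanifold this is its dimension; for a (possibly singular) real algebraic set it is the usual
dimension. The `d` in question are at most `dim E`, so the supremum is a maximum. -/
noncomputable def realDim {E : Type*} [NormedAddCommGroup E] [NormedSpace ℝ E]
    [FiniteDimensional ℝ E] (S : Set E) : ℕ :=
  sSup {d : ℕ | ∃ M : Set E, M ⊆ S ∧ M.Nonempty ∧ IsSmoothSubmanifold d M}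

/-- The real codimension of `S` inside `N`. -/
noncomputable def realCodim {E : Type*} [NormedAddCommGroup E] [NormedSpace ℝ E]
    [FiniteDimensional ℝ E] (S N : Set E) : ℤ :=
  (realDim N : ℤ) - (realDim S : ℤ)

/-- The distinct eigenvalues of `A` can be listed as `ev 0, …, ev (I - 1)` with algebraic
multiplicities `k 0, …, k (I - 1)` (for positive `k i`). -/
def HasMultiplicities {n I : ℕ} (k : Fin I → ℕ) (A : Matrix (Fin n) (Fin n) ℂ) : Prop :=
  ∃ ev : Fin I → ℂ, Function.Injective ev ∧
    A.charpoly = ∏ i, (Polynomial.X - Polynomial.C (ev i)) ^ k i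

/-- The set of normal `n × n` matrices. -/
def normalMatrices (n : ℕ) : Set (Matrix (Fin n) (Fin n) ℂ) :=
  {A | A * Aᴴ = Aᴴ * A}

/-- The set of normal `n × n` matrices with eigenvalue multiplicities `k`. -/
def normalMatricesWithMult (n : ℕ) {I : ℕ} (k : Fin I → ℕ) : Set (Matrix (Fin n) (Fin n) ℂ) :=
  {A | A ∈ normalMatrices n ∧ HasMultiplicities k A}

/-- The unitary orbit of `Λ`: the set of all `U Λ U*` with `U` unitary. -/
def unitaryOrbit {n : ℕ} (Λ : Matrix (Fin n) (Fin n) ℂ) : Set (Matrix (Fin n) (Fin n) ℂ) :=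
  {A | ∃ U ∈ Matrix.unitaryGroup (Fin n) ℂ, A = U * Λ * Uᴴ}

-- Hausdorff dimension and charts of submanifolds

section Submanifold

open Set Filter Topology Module

variable {E : Type*} [NormedAddCommGroup E] [NormedSpace ℝ E] [FiniteDimensional ℝ E]

-- By the spectral theorem, the normal matrices with multiplicities `k` are the union of the unitary
-- orbits of `Λ = diagonal (ev ∘ β)`, where `β` sorts the indices into blocks of sizes `k i` and
-- `ev` is injective. Unitary conjugation preserves all sets involved, so charts are needed only at
-- `Λ`.
--
-- Near `Λ` write `B = (1 + K) D (1 + K)⁻¹` with `D` block diagonal and `K` off-block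
-- (`blockCoord`). The derivative at the origin scales off-block entries by differences of distinct
-- eigenvalues, so these are local coordinates. In them, `B` lies in the stratum exactly when `D` is
-- block scalar and the column blocks of `1 + K` are orthogonal
-- (`mem_normalMatricesWithMult_iff_of_near`). Orthogonality reads `K + Kᴴ + offBlock (Kᴴ K) = 0`;
-- absorbing half of the Hermitian quadratic term into `K` (`straighten`) leaves a linear
-- skew-Hermitian condition. The block scalars give `2 I` real parameters, the skew-Hermitian
-- off-block part `n² - ∑ kᵢ²`. On an orbit the block scalars are frozen.
--
-- Upper bounds on dimension use Hausdorff dimension, which is monotone, countably stable, and equal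
-- to `d` on nonempty `d`-dimensional submanifolds. Normal matrices form a countable union of
-- strata, and the largest dimension occurs for simple spectrum.

/-- A smooth map does not raise the Hausdorff dimension. -/
theorem dimH_image_le_of_contDiffOn_isOpen {F : Type*} [NormedAddCommGroup F] [NormedSpace ℝ F]
    {f : E → F} {U s : Set E} (hU : IsOpen U) (hf : ContDiffOn ℝ ∞ f U) (hs : s ⊆ U) :
    dimH (f '' s) ≤ dimH s := by
  apply dimH_image_le_of_locally_lipschitzOn
  intro x hx
  have hx' : ContDiffAt ℝ 1 f x := (hf.contDiffAt (hU.mem_nhds (hs hx))).of_le (by simp)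
  obtain ⟨K, t, ht, h⟩ := hx'.exists_lipschitzOnWith
  exact ⟨K, t, mem_nhdsWithin_of_mem_nhds ht, h⟩

theorem dimH_submodule_inter_isOpen {L : Submodule ℝ E} {U : Set E} (hU : IsOpen U)
    (h : ((L : Set E) ∩ U).Nonempty) : dimH ((L : Set E) ∩ U) = finrank ℝ L := by
  obtain ⟨x, hxL, hxU⟩ := h
  have h1 : ((L : Set E) ∩ U) = (Subtype.val : L → E) '' (Subtype.val ⁻¹' U) := by
    ext y
    constructor
    · rintro ⟨hy, hyU⟩
      exact ⟨⟨y, hy⟩, hyU, rfl⟩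
    · rintro ⟨z, hz, rfl⟩
      exact ⟨z.2, hz⟩
  rw [h1]
  refine (L.subtypeₗᵢ.isometry.dimH_image _).trans ?_
  exact Real.dimH_of_mem_nhds (x := (⟨x, hxL⟩ : L))
    ((hU.preimage continuous_subtype_val).mem_nhds hxU)

/-- The chart and its inverse are both smooth, so neither raises Hausdorff dimension. -/
theorem dimH_chart {d : ℕ} {S : Set E} {φ : OpenPartialHomeomorph E E} {L : Submodule ℝ E} {x : E}
    (hxS : x ∈ S) (hx : x ∈ φ.source) (hL : finrank ℝ L = d)
    (h1 : ContDiffOn ℝ ∞ φ φ.source) (h2 : ContDiffOn ℝ ∞ φ.symm φ.target)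
    (h : φ '' (S ∩ φ.source) = (L : Set E) ∩ φ.target) : dimH (S ∩ φ.source) = d := by
  have hd : dimH ((L : Set E) ∩ φ.target) = d := by
    rw [← hL]
    apply dimH_submodule_inter_isOpen φ.open_target
    rw [← h]
    exact ⟨φ x, x, ⟨hxS, hx⟩, rfl⟩
  apply le_antisymm
  · have h3 : S ∩ φ.source = φ.symm '' ((L : Set E) ∩ φ.target) := by
      rw [← h, image_image]
      ext y
      constructor
      · intro hy
        exact ⟨y, hy, φ.left_inv hy.2⟩
      · rintro ⟨z, hz, rfl⟩
        simpa only [φ.left_inv hz.2] using hz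
    rw [h3, ← hd]
    exact dimH_image_le_of_contDiffOn_isOpen φ.open_target h2 inter_subset_right
  · rw [← hd, ← h]
    exact dimH_image_le_of_contDiffOn_isOpen φ.open_source h1 inter_subset_right

/-- Hausdorff dimension is local: if it exceeded `d`, it would exceed `d` on every neighbourhood of
some point of `S`, including a chart domain. -/
theorem IsSmoothSubmanifold.dimH_eq {d : ℕ} {S : Set E} (hS : IsSmoothSubmanifold d S)
    (hne : S.Nonempty) : dimH S = d := by
  apply le_antisymm
  · by_contra! hlt
    obtain ⟨x, hx, hx'⟩ := exists_mem_nhdsWithin_lt_dimH_of_lt_dimH hlt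
    obtain ⟨φ, L, hxs, hL, h1, h2, h⟩ := hS x hx
    have := hx' (S ∩ φ.source)
      (inter_mem_nhdsWithin _ (φ.open_source.mem_nhds hxs))
    rw [dimH_chart hx hxs hL h1 h2 h] at this
    exact lt_irrefl _ this
  · obtain ⟨x, hx⟩ := hne
    obtain ⟨φ, L, hxs, hL, h1, h2, h⟩ := hS x hx
    rw [← dimH_chart hx hxs hL h1 h2 h]
    exact dimH_mono inter_subset_left

/-- A set that contains a nonempty submanifold of dimension `d` and has Hausdorff dimension at
most `d` has real dimension `d`. -/
theorem realDim_eq_of_dimH_le {d : ℕ} {S M : Set E} (hMS : M ⊆ S) (hne : M.Nonempty)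
    (hM : IsSmoothSubmanifold d M) (hS : dimH S ≤ d) : realDim S = d := by
  apply IsGreatest.csSup_eq
  refine ⟨⟨M, hMS, hne, hM⟩, ?_⟩
  rintro e ⟨N, hNS, hN, hN'⟩
  have := (dimH_mono hNS).trans hS
  rw [hN'.dimH_eq hN] at this
  exact_mod_cast this

theorem IsSmoothSubmanifold.realDim_eq {d : ℕ} {S : Set E} (hS : IsSmoothSubmanifold d S)
    (hne : S.Nonempty) : realDim S = d :=
  realDim_eq_of_dimH_le subset_rfl hne hS (hS.dimH_eq hne).le

/-- The inverse function theorem, with smoothness on the whole source and target. -/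
theorem exists_smooth_openPartialHomeomorph {f : E → E} {a : E} {f' : E ≃L[ℝ] E}
    (hf : ∀ᶠ x in 𝓝 a, ContDiffAt ℝ ∞ f x) (hf' : HasFDerivAt f (f' : E →L[ℝ] E) a) :
    ∃ p : OpenPartialHomeomorph E E, a ∈ p.source ∧ ⇑p = f ∧
      ContDiffOn ℝ ∞ p p.source ∧ ContDiffOn ℝ ∞ p.symm p.target := by
  have hfa : ContDiffAt ℝ ∞ f a := hf.self_of_nhds
  let q := hfa.toOpenPartialHomeomorph f hf' (by simp)
  have hq : ⇑q = f := rfl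
  have hcont : ContinuousAt (fderiv ℝ f) a :=
    (hfa.fderiv_right (m := 0) (by simp)).continuousAt
  -- Invertibility of the derivative is an open condition; shrinking to it makes the inverse smooth
  -- on the whole target, not only near `f a`.
  have hunit : ∀ᶠ x in 𝓝 a, fderiv ℝ f x ∈ range ((↑) : (E ≃L[ℝ] E) → E →L[ℝ] E) := by
    apply hcont
    rw [hf'.fderiv]
    exact ContinuousLinearEquiv.nhds f'
  obtain ⟨V, hV, hVo, haV⟩ := eventually_nhds_iff.1 (hf.and hunit)
  refine ⟨q.restrOpen V hVo, ⟨hfa.mem_toOpenPartialHomeomorph_source hf' (by simp), haV⟩, rfl,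
    ?_, ?_⟩
  · intro x hx
    exact (hV x hx.2).1.contDiffWithinAt
  · intro y hy
    set p := q.restrOpen V hVo with hp
    have hx : p.symm y ∈ p.source := p.map_target hy
    obtain ⟨h1, e, he⟩ := hV _ hx.2
    refine (p.contDiffAt_symm (f₀' := e) hy ?_ h1).contDiffWithinAt
    rw [he]
    exact (h1.differentiableAt (by simp)).hasFDerivAt

/-- `S` is an embedded smooth submanifold of dimension `d` near `x`. -/
def HasSubmanifoldChart (d : ℕ) (S : Set E) (x : E) : Prop :=
  ∃ (φ : OpenPartialHomeomorph E E) (L : Submodule ℝ E),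
    x ∈ φ.source ∧ finrank ℝ L = d ∧
    ContDiffOn ℝ ∞ φ φ.source ∧ ContDiffOn ℝ ∞ φ.symm φ.target ∧
    φ '' (S ∩ φ.source) = (L : Set E) ∩ φ.target

/-- A set that corresponds to a linear subspace under two local diffeomorphisms is a submanifold
near the base point. -/
theorem hasSubmanifoldChart_of_eventually {f g : E → E} {a : E} {f' g' : E ≃L[ℝ] E} {S : Set E}
    {L : Submodule ℝ E}
    (hf : ∀ᶠ x in 𝓝 a, ContDiffAt ℝ ∞ f x) (hf' : HasFDerivAt f (f' : E →L[ℝ] E) a)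
    (hg : ∀ᶠ x in 𝓝 a, ContDiffAt ℝ ∞ g x) (hg' : HasFDerivAt g (g' : E →L[ℝ] E) a)
    (h : ∀ᶠ x in 𝓝 a, (f x ∈ S ↔ g x ∈ L)) :
    HasSubmanifoldChart (finrank ℝ L) S (f a) := by
  obtain ⟨p, hap, hpf, hp1, hp2⟩ := exists_smooth_openPartialHomeomorph hf hf'
  obtain ⟨q, haq, hqg, hq1, hq2⟩ := exists_smooth_openPartialHomeomorph hg hg'
  obtain ⟨V, hV, hVo, haV⟩ := eventually_nhds_iff.1 h
  -- The chart is `g ∘ f⁻¹`, restricted to where the equivalence `h` holds.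
  set φ := p.symm.trans (q.restrOpen V hVo) with hφ
  have hsrc : ∀ y, y ∈ φ.source ↔ y ∈ p.target ∧ p.symm y ∈ q.source ∧ p.symm y ∈ V := by
    intro y
    simp [hφ]
  have hsrc' : ∀ x ∈ p.source, x ∈ q.source → x ∈ V → p x ∈ φ.source := by
    intro x hx1 hx2 hx3
    rw [hsrc, p.left_inv hx1]
    exact ⟨p.map_source hx1, hx2, hx3⟩
  have hcoe : ∀ y, φ y = q (p.symm y) := fun y => rfl
  have hcoe' : ∀ y, φ.symm y = p (q.symm y) := fun y => rfl
  have htgt : ∀ y ∈ φ.target, y ∈ q.target ∧ q.symm y ∈ p.source := by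
    intro y hy
    have h1 := φ.map_target hy
    rw [hsrc, hcoe'] at h1
    have h2 : y ∈ (q.restrOpen V hVo).target ∧ q.symm y ∈ p.source := by
      simpa [hφ, OpenPartialHomeomorph.trans_target] using hy
    refine ⟨?_, h2.2⟩
    have h3 := (q.restrOpen V hVo).map_target h2.1
    have h4 : q ((q.restrOpen V hVo).symm y) ∈ q.target := q.map_source h3.1
    have h5 : q ((q.restrOpen V hVo).symm y) = y := (q.restrOpen V hVo).right_inv h2.1
    rwa [h5] at h4
  refine ⟨φ, L, ?_, rfl, ?_, ?_, ?_⟩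
  · rw [← hpf]
    exact hsrc' a hap haq haV
  · exact hq1.comp (hp2.mono fun y hy => ((hsrc y).1 hy).1) fun y hy => ((hsrc y).1 hy).2.1
  · exact hp1.comp (hq2.mono fun y hy => (htgt y hy).1) fun y hy => (htgt y hy).2
  · have key : ∀ y ∈ φ.source, (y ∈ S ↔ φ y ∈ L) := by
      intro y hy
      have h1 := (hsrc y).1 hy
      have h2 := hV _ h1.2.2
      rwa [← hpf, ← hqg, p.right_inv h1.1] at h2
    ext z
    constructor
    · rintro ⟨y, ⟨hyS, hy⟩, rfl⟩
      exact ⟨(key y hy).1 hyS, φ.map_source hy⟩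
    · rintro ⟨hzL, hz⟩
      refine ⟨φ.symm z, ⟨(key _ (φ.map_target hz)).2 ?_, φ.map_target hz⟩, φ.right_inv hz⟩
      rwa [φ.right_inv hz]

end Submanifold

-- Transport of charts by linear automorphisms

section SubmanifoldMap

variable {E : Type*} [NormedAddCommGroup E] [NormedSpace ℝ E]

/-- Linear automorphisms that preserve a set map submanifold charts to submanifold charts. -/
theorem HasSubmanifoldChart.map {d : ℕ} {S : Set E} {x : E} (h : HasSubmanifoldChart d S x)
    (e : E ≃L[ℝ] E) (he : ∀ y, e y ∈ S ↔ y ∈ S) : HasSubmanifoldChart d S (e x) := by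
  obtain ⟨φ, L, hx, hL, h1, h2, h3⟩ := h
  set ψ := e.symm.toHomeomorph.toOpenPartialHomeomorph.trans φ with hψ
  have hsrc : ∀ y, y ∈ ψ.source ↔ e.symm y ∈ φ.source := by
    intro y
    simp [hψ]
  have htgt : ψ.target = φ.target := by
    simp [hψ]
  refine ⟨ψ, L, ?_, hL, ?_, ?_, ?_⟩
  · rw [hsrc]
    simpa using hx
  · exact h1.comp e.symm.contDiff.contDiffOn fun y hy => (hsrc y).1 hy
  · rw [htgt]
    exact e.contDiff.comp_contDiffOn h2
  · rw [htgt, ← h3]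
    ext z
    constructor
    · rintro ⟨y, ⟨hyS, hy⟩, rfl⟩
      refine ⟨e.symm y, ⟨?_, (hsrc y).1 hy⟩, rfl⟩
      rw [← he]
      simpa using hyS
    · rintro ⟨y, ⟨hyS, hy⟩, rfl⟩
      refine ⟨e y, ⟨(he y).2 hyS, ?_⟩, ?_⟩
      · rw [hsrc]
        simpa using hy
      · change φ (e.symm (e y)) = φ y
        simp

end SubmanifoldMap

-- Spectral theorem for normal operators

section Spectral

open Module End

variable {V : Type*} [NormedAddCommGroup V] [InnerProductSpace ℂ V] [FiniteDimensional ℂ V]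

open ContinuousLinearMap in
-- `T - μ` is again normal, and a normal operator and its adjoint have the same kernel.
theorem IsStarNormal.adjoint_apply_of_apply_eq_smul {T : V →L[ℂ] V} (hT : IsStarNormal T) {μ : ℂ}
    {v : V} (hv : T v = μ • v) : adjoint T v = (starRingEnd ℂ μ) • v := by
  have h : IsStarNormal (T - μ • (1 : V →L[ℂ] V)) := by
    constructor
    have := hT.star_comm_self
    simp only [star_sub, star_smul, star_one]
    apply Commute.sub_left
    · apply Commute.sub_right this
      exact (Commute.one_right _).smul_right _
    · exact (Commute.one_left _).smul_left _
  have h2 := (h.adjoint_apply_eq_zero_iff v).2 (by simp [hv])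
  rw [← star_eq_adjoint] at h2 ⊢
  simpa [sub_eq_zero] using h2

theorem IsStarNormal.orthogonalFamily_eigenspaces {T : V →L[ℂ] V} (hT : IsStarNormal T) :
    OrthogonalFamily ℂ (fun μ => eigenspace (T : V →ₗ[ℂ] V) μ)
      fun μ => (eigenspace (T : V →ₗ[ℂ] V) μ).subtypeₗᵢ := by
  rintro μ ν hμν ⟨v, hv⟩ ⟨w, hw⟩
  rw [mem_eigenspace_iff] at hv hw
  have h1 := hT.adjoint_apply_of_apply_eq_smul (v := v) (μ := μ) hv
  have h2 := ContinuousLinearMap.adjoint_inner_left T w v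
  have hw' : T w = ν • w := hw
  rw [h1, hw', inner_smul_left, inner_smul_right, Complex.conj_conj] at h2
  exact (mul_eq_mul_right_iff.1 h2).resolve_left hμν

/-- The adjoint acts on eigenvectors by scalars, so the complement is `T`-invariant; if nonzero, it
would contain an eigenvector, orthogonal to itself. -/
theorem IsStarNormal.orthogonal_iSup_eigenspaces {T : V →L[ℂ] V} (hT : IsStarNormal T) :
    (⨆ μ, eigenspace (T : V →ₗ[ℂ] V) μ)ᗮ = ⊥ := by
  set W := (⨆ μ, eigenspace (T : V →ₗ[ℂ] V) μ)ᗮ with hW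
  have hmem : ∀ w, w ∈ W ↔ ∀ (μ : ℂ) (v : V), T v = μ • v → inner ℂ v w = 0 := by
    intro w
    rw [hW, ← Submodule.iInf_orthogonal, Submodule.mem_iInf]
    refine forall_congr' fun μ => ?_
    rw [Submodule.mem_orthogonal]
    refine forall_congr' fun v => ?_
    rw [mem_eigenspace_iff]
    rfl
  have hinv : ∀ w ∈ W, (T : V →ₗ[ℂ] V) w ∈ W := by
    intro w hw
    rw [hmem] at hw ⊢
    intro μ v hv
    have h1 := ContinuousLinearMap.adjoint_inner_left T w v
    rw [hT.adjoint_apply_of_apply_eq_smul hv, inner_smul_left, hw μ v hv, mul_zero] at h1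
    exact h1.symm
  by_contra hne
  have : Nontrivial W := Submodule.nontrivial_iff_ne_bot.2 hne
  obtain ⟨c, hc⟩ := Module.End.exists_eigenvalue ((T : V →ₗ[ℂ] V).restrict hinv)
  obtain ⟨v, hv⟩ := hc.exists_hasEigenvector
  have hv1 : T v = c • (v : V) := congrArg Subtype.val hv.apply_eq_smul
  have h2 := (hmem v).1 v.2 c v hv1
  rw [inner_self_eq_zero] at h2
  exact hv.2 (Subtype.ext h2)

/-- The spectral theorem for normal operators. -/
theorem IsStarNormal.exists_orthonormalBasis {T : V →L[ℂ] V} (hT : IsStarNormal T) {n : ℕ}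
    (hn : finrank ℂ V = n) :
    ∃ (b : OrthonormalBasis (Fin n) ℂ V) (μ : Fin n → ℂ), ∀ i, T (b i) = μ i • b i := by
  have hof : OrthogonalFamily ℂ (fun μ : Eigenvalues (T : V →ₗ[ℂ] V) =>
      eigenspace (T : V →ₗ[ℂ] V) μ) fun μ => (eigenspace (T : V →ₗ[ℂ] V) μ).subtypeₗᵢ :=
    hT.orthogonalFamily_eigenspaces.comp Subtype.coe_injective
  have hint : DirectSum.IsInternal fun μ : Eigenvalues (T : V →ₗ[ℂ] V) =>
      eigenspace (T : V →ₗ[ℂ] V) μ := by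
    rw [hof.isInternal_iff]
    change (⨆ μ : { μ // eigenspace (T : V →ₗ[ℂ] V) μ ≠ ⊥ }, eigenspace (T : V →ₗ[ℂ] V) μ)ᗮ = ⊥
    rw [iSup_ne_bot_subtype, hT.orthogonal_iSup_eigenspaces]
  refine ⟨hint.subordinateOrthonormalBasis hn hof,
    fun i => (hint.subordinateOrthonormalBasisIndex hn i hof).1, fun i => ?_⟩
  exact mem_eigenspace_iff.1 (hint.subordinateOrthonormalBasis_subordinate hn i hof)

end Spectral

-- Normal matrices up to unitary conjugation

section NormalMatrix

open Matrix

variable {n : ℕ}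

/-- The spectral theorem for normal matrices. -/
theorem exists_unitary_diagonal_of_mem_normalMatrices {A : Matrix (Fin n) (Fin n) ℂ}
    (hA : A ∈ normalMatrices n) :
    ∃ U ∈ unitaryGroup (Fin n) ℂ, ∃ μ : Fin n → ℂ, A = U * diagonal μ * Uᴴ := by
  have hT : IsStarNormal (toEuclideanCLM (n := Fin n) (𝕜 := ℂ) A) := by
    constructor
    have h : Aᴴ * A = A * Aᴴ := Eq.symm hA
    rw [← map_star, star_eq_conjTranspose]
    change _ * _ = _ * _
    rw [← map_mul, ← map_mul, h]
  obtain ⟨b, μ, hb⟩ := hT.exists_orthonormalBasis (n := n) (by simp)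
  set U : Matrix (Fin n) (Fin n) ℂ :=
    (EuclideanSpace.basisFun (Fin n) ℂ).toBasis.toMatrix b.toBasis with hU
  have hUu : U ∈ unitaryGroup (Fin n) ℂ :=
    (EuclideanSpace.basisFun (Fin n) ℂ).toMatrix_orthonormalBasis_mem_unitary b
  have hUa : ∀ i j, U i j = b j i := fun i j => rfl
  have h1 : A * U = U * diagonal μ := by
    ext i j
    have h2 := congrArg (fun v : EuclideanSpace ℂ (Fin n) => v i) (hb j)
    simp only [ofLp_toEuclideanCLM] at h2
    rw [mul_diagonal, mul_apply, hUa]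
    simpa [mulVec, dotProduct, hUa, mul_comm] using h2
  refine ⟨U, hUu, μ, ?_⟩
  have h3 : U * Uᴴ = 1 := mem_unitaryGroup_iff.1 hUu
  rw [← h1, Matrix.mul_assoc, h3, Matrix.mul_one]

variable {U A B T : Matrix (Fin n) (Fin n) ℂ} {d : Fin n → ℂ}

theorem unitaryGroup_conjTranspose_mul (hU : U ∈ unitaryGroup (Fin n) ℂ) : Uᴴ * U = 1 :=
  mem_unitaryGroup_iff'.1 hU

theorem unitaryGroup_mul_conjTranspose (hU : U ∈ unitaryGroup (Fin n) ℂ) : U * Uᴴ = 1 :=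
  mem_unitaryGroup_iff.1 hU

theorem conj_eq_iff (hU : U ∈ unitaryGroup (Fin n) ℂ) : U * A * Uᴴ = B ↔ A = Uᴴ * B * U := by
  have h1 := unitaryGroup_conjTranspose_mul hU
  have h2 := unitaryGroup_mul_conjTranspose hU
  constructor
  · rintro rfl
    rw [← Matrix.mul_assoc, ← Matrix.mul_assoc, h1, Matrix.one_mul, Matrix.mul_assoc, h1,
      Matrix.mul_one]
  · rintro rfl
    rw [← Matrix.mul_assoc, ← Matrix.mul_assoc, h2, Matrix.one_mul, Matrix.mul_assoc, h2,
      Matrix.mul_one]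

theorem charpoly_unitary_conj (hU : U ∈ unitaryGroup (Fin n) ℂ) :
    (U * A * Uᴴ).charpoly = A.charpoly := by
  let V : (Matrix (Fin n) (Fin n) ℂ)ˣ :=
    ⟨U, Uᴴ, unitaryGroup_mul_conjTranspose hU, unitaryGroup_conjTranspose_mul hU⟩
  have h := charpoly_units_conj V A
  rwa [← coe_units_inv] at h

theorem conj_mem_normalMatrices (hU : U ∈ unitaryGroup (Fin n) ℂ) :
    U * A * Uᴴ ∈ normalMatrices n ↔ A ∈ normalMatrices n := by
  have h1 := unitaryGroup_conjTranspose_mul hU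
  have h3 : ∀ C D : Matrix (Fin n) (Fin n) ℂ, (U * C * Uᴴ) * (U * D * Uᴴ) = U * (C * D) * Uᴴ := by
    intro C D
    calc (U * C * Uᴴ) * (U * D * Uᴴ) = U * C * (Uᴴ * U) * D * Uᴴ := by
          simp only [Matrix.mul_assoc]
      _ = _ := by rw [h1]; simp only [Matrix.mul_assoc, Matrix.mul_one]
  have h4 : (U * A * Uᴴ)ᴴ = U * Aᴴ * Uᴴ := by
    simp [conjTranspose_mul, Matrix.mul_assoc]
  change _ = _ ↔ _ = _
  rw [h4, h3, h3, conj_eq_iff hU, ← (conj_eq_iff hU).1 (rfl : U * (Aᴴ * A) * Uᴴ = _)]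

theorem conj_mem_normalMatricesWithMult {I : ℕ} {k : Fin I → ℕ} (hU : U ∈ unitaryGroup (Fin n) ℂ) :
    U * A * Uᴴ ∈ normalMatricesWithMult n k ↔ A ∈ normalMatricesWithMult n k := by
  simp only [normalMatricesWithMult, Set.mem_ofPred_eq, conj_mem_normalMatrices hU,
    HasMultiplicities, charpoly_unitary_conj hU]

theorem conj_mem_unitaryOrbit {Λ : Matrix (Fin n) (Fin n) ℂ} (hU : U ∈ unitaryGroup (Fin n) ℂ) :
    U * A * Uᴴ ∈ unitaryOrbit Λ ↔ A ∈ unitaryOrbit Λ := by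
  constructor
  · rintro ⟨V, hV, h⟩
    rw [conj_eq_iff hU] at h
    refine ⟨Uᴴ * V, mul_mem (Unitary.star_mem hU) hV, ?_⟩
    rw [h]
    simp [conjTranspose_mul, Matrix.mul_assoc]
  · rintro ⟨V, hV, rfl⟩
    refine ⟨U * V, mul_mem hU hV, ?_⟩
    simp [conjTranspose_mul, Matrix.mul_assoc]

theorem diagonal_mem_normalMatrices : diagonal d ∈ normalMatrices n := by
  change _ = _
  simp [diagonal_conjTranspose, mul_comm]

/-- Equal counts make the fibres of `f` and `g` over each value equinumerous; bijections of fibres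
glue to a permutation. -/
theorem exists_perm_of_multiset_map_eq {α ι : Type*} [Fintype ι] {f g : ι → α}
    (h : Finset.univ.val.map f = Finset.univ.val.map g) : ∃ σ : Equiv.Perm ι, f = g ∘ σ := by
  classical
  have hcard : ∀ c, Nonempty ({a // f a = c} ≃ {a // g a = c}) := by
    intro c
    have h1 := congrArg (Multiset.count c) h
    rw [Multiset.count_map, Multiset.count_map] at h1
    refine ⟨Fintype.equivOfCardEq ?_⟩
    rw [Fintype.card_subtype, Fintype.card_subtype]
    simp only [eq_comm (b := c)]
    exact h1
  let e := fun c => (hcard c).some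
  exact ⟨Equiv.ofFiberEquiv e, funext fun a => (Equiv.ofFiberEquiv_map e a).symm⟩

/-- A normal matrix is unitarily equivalent to every diagonal matrix with the same characteristic
polynomial. -/
theorem mem_unitaryOrbit_diagonal_iff :
    A ∈ unitaryOrbit (diagonal d) ↔
      A ∈ normalMatrices n ∧ A.charpoly = (diagonal d).charpoly := by
  constructor
  · rintro ⟨U, hU, rfl⟩
    exact ⟨(conj_mem_normalMatrices hU).2 diagonal_mem_normalMatrices, charpoly_unitary_conj hU⟩
  · rintro ⟨hA, hc⟩
    obtain ⟨U, hU, μ, rfl⟩ := exists_unitary_diagonal_of_mem_normalMatrices hA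
    rw [charpoly_unitary_conj hU, charpoly_diagonal, charpoly_diagonal] at hc
    have h1 := congrArg Polynomial.roots hc
    rw [Polynomial.roots_prod _ _ (Finset.prod_ne_zero_iff.2 fun i _ => Polynomial.X_sub_C_ne_zero _),
      Polynomial.roots_prod _ _
        (Finset.prod_ne_zero_iff.2 fun i _ => Polynomial.X_sub_C_ne_zero _)] at h1
    simp only [Polynomial.roots_X_sub_C, Multiset.bind_singleton] at h1
    obtain ⟨σ, hσ⟩ := exists_perm_of_multiset_map_eq h1
    -- Conjugation by a permutation matrix permutes diagonal entries; taking `e = 1` shows that this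
    -- matrix is unitary.
    have hP : ∀ e : Fin n → ℂ, (1 : Matrix (Fin n) (Fin n) ℂ).submatrix σ id * diagonal e *
        ((1 : Matrix (Fin n) (Fin n) ℂ).submatrix σ id)ᴴ = diagonal (e ∘ σ) := by
      intro e
      ext a b
      by_cases hab : a = b <;> simp [mul_apply, diagonal_apply, one_apply, hab]
    rw [conj_mem_unitaryOrbit hU, hσ]
    refine ⟨(1 : Matrix (Fin n) (Fin n) ℂ).submatrix σ id, ?_, (hP d).symm⟩
    rw [mem_unitaryGroup_iff, star_eq_conjTranspose]
    simpa using hP 1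

/-- If `T` maps an eigenbasis of standard vectors to eigenvectors of a normal matrix `B`, the same
holds for the adjoint of `B`. -/
theorem conjTranspose_mul_eq_of_normal (hB : B ∈ normalMatrices n) (h : B * T = T * diagonal d) :
    Bᴴ * T = T * (diagonal d)ᴴ := by
  obtain ⟨U, hU, μ, rfl⟩ := exists_unitary_diagonal_of_mem_normalMatrices hB
  have h1 := unitaryGroup_conjTranspose_mul hU
  have h2 := unitaryGroup_mul_conjTranspose hU
  have h3 : diagonal μ * (Uᴴ * T) = (Uᴴ * T) * diagonal d := by
    rw [Matrix.mul_assoc Uᴴ, ← h]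
    simp only [← Matrix.mul_assoc, h1, Matrix.one_mul]
  -- Entrywise, `h3` says that `μ a = d b` or the entry of `Uᴴ * T` vanishes; either case survives
  -- conjugation of the eigenvalues.
  have h4 : (diagonal μ)ᴴ * (Uᴴ * T) = (Uᴴ * T) * (diagonal d)ᴴ := by
    ext a b
    have h5 := congrFun (congrFun h3 a) b
    rw [diagonal_mul, mul_diagonal, mul_comm, ← sub_eq_zero, ← mul_sub, mul_eq_zero] at h5
    rw [diagonal_conjTranspose, diagonal_conjTranspose, diagonal_mul, mul_diagonal]
    rcases h5 with h5 | h5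
    · simp [h5]
    · simp [sub_eq_zero.1 h5, mul_comm]
  calc (U * diagonal μ * Uᴴ)ᴴ * T = U * ((diagonal μ)ᴴ * (Uᴴ * T)) := by
        simp [conjTranspose_mul, Matrix.mul_assoc]
    _ = _ := by rw [h4]; simp only [← Matrix.mul_assoc, h2, Matrix.one_mul]

/-- A matrix with eigenbasis `T` is normal if and only if the Gram matrix of `T` commutes with the
diagonal matrix of eigenvalues. -/
theorem mem_normalMatrices_iff_of_mul_eq (hT : IsUnit T) (h : B * T = T * diagonal d) :
    B ∈ normalMatrices n ↔ ∀ a b, d a ≠ d b → (Tᴴ * T) a b = 0 := by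
  have hcomm : (∀ a b, d a ≠ d b → (Tᴴ * T) a b = 0) ↔
      diagonal d * (Tᴴ * T) = (Tᴴ * T) * diagonal d := by
    constructor
    · intro h1
      ext a b
      rw [diagonal_mul, mul_diagonal]
      by_cases hab : d a = d b
      · rw [hab, mul_comm]
      · rw [h1 a b hab, zero_mul, mul_zero]
    · intro h1 a b hab
      have h2 := congrFun (congrFun h1 a) b
      rw [diagonal_mul, mul_diagonal, mul_comm, ← sub_eq_zero, ← mul_sub, mul_eq_zero] at h2
      exact h2.resolve_right (sub_ne_zero.2 hab)
  rw [hcomm]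
  have hB1 : Tᴴ * B * T = (Tᴴ * T) * diagonal d := by
    rw [Matrix.mul_assoc, h, Matrix.mul_assoc]
  constructor
  · intro hB
    have h1 := congrArg conjTranspose (conjTranspose_mul_eq_of_normal hB h)
    simp only [conjTranspose_mul, conjTranspose_conjTranspose] at h1
    rw [← hB1, h1, Matrix.mul_assoc]
  · intro hc
    have h1 : Tᴴ * B = diagonal d * Tᴴ := by
      apply hT.mul_right_cancel
      rw [hB1, ← hc, Matrix.mul_assoc]
    have h2 := congrArg conjTranspose h1
    simp only [conjTranspose_mul, conjTranspose_conjTranspose] at h2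
    change _ = _
    apply hT.mul_right_cancel
    rw [Matrix.mul_assoc, h2, ← Matrix.mul_assoc, h, Matrix.mul_assoc Bᴴ, h, ← Matrix.mul_assoc, h2,
      Matrix.mul_assoc, Matrix.mul_assoc]
    congr 1
    exact (diagonal_mem_normalMatrices (d := d))

end NormalMatrix

-- Rigidity of block diagonal matrices near a block scalar one

section BlockDiagonal

open Matrix

variable {n I : ℕ} {β : Fin n → Fin I}

theorem eq_of_norm_sub_lt {ev : Fin I → ℂ} {δ : ℝ}
    (hsep : ∀ i j, i ≠ j → 2 * δ ≤ ‖ev i - ev j‖) {z : ℂ} {i j : Fin I}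
    (hi : ‖z - ev i‖ < δ) (hj : ‖z - ev j‖ < δ) : i = j := by
  by_contra hij
  have h1 : ‖ev i - ev j‖ ≤ ‖z - ev j‖ + ‖z - ev i‖ := by
    have : ev i - ev j = (z - ev j) - (z - ev i) := by ring
    rw [this]
    exact norm_sub_le _ _
  linarith [hsep i j hij]

/-- A diagonalizable block diagonal matrix that is close to a block scalar one and has at most as
many eigenvalues as blocks is itself block scalar. -/
theorem exists_eq_diagonal_of_near {D G : Matrix (Fin n) (Fin n) ℂ} {ev ν : Fin I → ℂ}
    {μ : Fin n → ℂ} {δ : ℝ} (hβ : Function.Surjective β)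
    (hD : ∀ a b, β a ≠ β b → D a b = 0)
    (hnear : ∀ a, ∑ b, ‖(D - diagonal (ev ∘ β)) a b‖ < δ)
    (hsep : ∀ i j, i ≠ j → 2 * δ ≤ ‖ev i - ev j‖)
    (hG : IsUnit G) (hDG : D * G = G * diagonal μ) (hμ : ∀ c, ∃ i, μ c = ν i) :
    ∃ θ : Fin I → ℂ, D = diagonal (θ ∘ β) := by
  set H := D - diagonal (ev ∘ β) with hH
  have hHz : ∀ a b, β a ≠ β b → H a b = 0 := by
    intro a b hab
    have hab' : a ≠ b := fun h => hab (congrArg β h)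
    simp [hH, hD a b hab, hab']
  -- Gershgorin's argument inside one block: compare the eigenvector equation in the row `m` where
  -- column `c` of `G` is largest among the rows of the block of `a`.
  have gersh : ∀ a c, G a c ≠ 0 → ‖μ c - ev (β a)‖ < δ := by
    intro a c hac
    obtain ⟨m, hm, hmax⟩ := Finset.exists_max_image (Finset.univ.filter fun b => β b = β a)
      (fun b => ‖G b c‖) ⟨a, by simp⟩
    simp only [Finset.mem_filter, Finset.mem_univ, true_and] at hm hmax
    have hpos : 0 < ‖G m c‖ := (norm_pos_iff.2 hac).trans_le (hmax a rfl)
    have heq : (μ c - ev (β a)) * G m c = ∑ b, H m b * G b c := by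
      have h1 := congrFun (congrFun hDG m) c
      have h2 : (H * G) m c = (D * G) m c - (diagonal (ev ∘ β) * G) m c := by
        rw [hH, Matrix.sub_mul, Matrix.sub_apply]
      rw [← mul_apply, h2, h1, mul_diagonal, diagonal_mul, Function.comp_apply, hm]
      ring
    have hle : ‖μ c - ev (β a)‖ * ‖G m c‖ ≤ (∑ b, ‖H m b‖) * ‖G m c‖ := by
      rw [← norm_mul, heq, Finset.sum_mul]
      refine (norm_sum_le _ _).trans (Finset.sum_le_sum fun b _ => ?_)
      rw [norm_mul]
      by_cases hb : β b = β a
      · exact mul_le_mul_of_nonneg_left (hmax b hb) (norm_nonneg _)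
      · rw [hHz m b (by rw [hm]; exact Ne.symm hb)]
        simp
    exact (le_of_mul_le_mul_right hle hpos).trans_lt (hnear m)
  obtain ⟨G', hG'⟩ := hG
  have hrow : ∀ a, ∃ c, G a c ≠ 0 := by
    intro a
    by_contra! h
    have h1 := congrFun (congrFun G'.mul_inv a) a
    rw [hG', mul_apply, one_apply_eq] at h1
    simp [h] at h1
  have hcol : ∀ c, ∃ a, G a c ≠ 0 := by
    intro c
    by_contra! h
    have h1 := congrFun (congrFun G'.inv_mul c) c
    rw [hG', mul_apply, one_apply_eq] at h1
    simp [h] at h1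
  choose col hcolne using fun i => hrow (hβ i).choose
  have hβc : ∀ i, β (hβ i).choose = i := fun i => (hβ i).choose_spec
  have hθ : ∀ i, ‖μ (col i) - ev i‖ < δ := by
    intro i
    have := gersh _ _ (hcolne i)
    rwa [hβc] at this
  choose τ hτ using fun i => hμ (col i)
  -- One eigenvalue is selected near each `ev i`. They are distinct and there are only `I`
  -- candidates, so by pigeonhole every eigenvalue of `D` is one of them.
  have hτinj : Function.Injective τ := by
    intro i j hij
    refine eq_of_norm_sub_lt hsep (z := μ (col i)) (hθ i) ?_
    rw [hτ i, hij, ← hτ j]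
    exact hθ j
  have hτsurj := Finite.surjective_of_injective hτinj
  refine ⟨fun i => μ (col i), ?_⟩
  apply (Units.mul_left_inj G').1
  rw [hG', hDG]
  ext a c
  rw [mul_diagonal, diagonal_mul]
  by_cases hac : G a c = 0
  · simp [hac]
  obtain ⟨j, hj⟩ := hμ c
  obtain ⟨i, rfl⟩ := hτsurj j
  rw [← hτ] at hj
  have : i = β a := by
    refine eq_of_norm_sub_lt hsep (z := μ c) ?_ (gersh a c hac)
    rw [hj]
    exact hθ i
  rw [hj, this, mul_comm]
  rfl

theorem charpoly_diagonal_comp {k : Fin I → ℕ}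
    (hcard : ∀ i, (Finset.univ.filter fun a => β a = i).card = k i) (θ : Fin I → ℂ) :
    (diagonal (θ ∘ β)).charpoly = ∏ i, (Polynomial.X - Polynomial.C (θ i)) ^ k i := by
  rw [charpoly_diagonal]
  have := Finset.prod_fiberwise' (Finset.univ : Finset (Fin n)) β
    (fun i => Polynomial.X - Polynomial.C (θ i))
  simp only [Function.comp_apply]
  rw [← this]
  refine Finset.prod_congr rfl fun i _ => ?_
  rw [Finset.prod_const, hcard]

theorem isRoot_prod_iff {k : Fin I → ℕ} {ev : Fin I → ℂ} {z : ℂ}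
    (h : (∏ i, (Polynomial.X - Polynomial.C (ev i)) ^ k i).eval z = 0) : ∃ i, z = ev i := by
  rw [Polynomial.eval_prod, Finset.prod_eq_zero_iff] at h
  obtain ⟨i, -, hi⟩ := h
  refine ⟨i, ?_⟩
  rw [Polynomial.eval_pow] at hi
  have := eq_zero_of_pow_eq_zero hi
  simpa [sub_eq_zero] using this

theorem diagonal_eval_charpoly {μ : Fin n → ℂ} (c : Fin n) :
    (diagonal μ).charpoly.eval (μ c) = 0 := by
  rw [charpoly_diagonal, Polynomial.eval_prod]
  exact Finset.prod_eq_zero (Finset.mem_univ c) (by simp)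

theorem norm_sub_lt_of_near {ev θ : Fin I → ℂ} {δ : ℝ} (hβ : Function.Surjective β)
    (hnear : ∀ a, ∑ b, ‖(diagonal (θ ∘ β) - diagonal (ev ∘ β)) a b‖ < δ) (i : Fin I) :
    ‖θ i - ev i‖ < δ := by
  obtain ⟨a, rfl⟩ := hβ i
  refine lt_of_le_of_lt ?_ (hnear a)
  have := Finset.single_le_sum (f := fun b => ‖(diagonal (θ ∘ β) - diagonal (ev ∘ β)) a b‖)
    (fun b _ => norm_nonneg _) (Finset.mem_univ a)
  simpa using this

variable {k : Fin I → ℕ} {D T B : Matrix (Fin n) (Fin n) ℂ} {ev : Fin I → ℂ} {δ : ℝ}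

theorem injective_of_near (hsep : ∀ i j, i ≠ j → 2 * δ ≤ ‖ev i - ev j‖) {θ : Fin I → ℂ}
    (h : ∀ i, ‖θ i - ev i‖ < δ) : Function.Injective θ := by
  intro i j hij
  refine eq_of_norm_sub_lt hsep (z := θ i) (h i) ?_
  rw [hij]
  exact h j

theorem charpoly_eq_of_mul_eq (hT : IsUnit T) (hB : B * T = T * D) :
    B.charpoly = D.charpoly := by
  obtain ⟨V, rfl⟩ := hT
  have h1 : B = V.val * D * V⁻¹.val := by
    rw [← hB, Matrix.mul_assoc, Units.mul_inv, Matrix.mul_one]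
  rw [h1]
  have h := charpoly_units_conj V D
  rwa [← coe_units_inv] at h

/-- Near a normal matrix with given multiplicities, in the coordinates `B = T D T⁻¹` with `D` block
diagonal, the normal matrices with these multiplicities are those with `D` block scalar and
mutually orthogonal blocks of columns of `T`. -/
theorem mem_normalMatricesWithMult_iff_of_near (hβ : Function.Surjective β)
    (hcard : ∀ i, (Finset.univ.filter fun a => β a = i).card = k i)
    (hsep : ∀ i j, i ≠ j → 2 * δ ≤ ‖ev i - ev j‖)
    (hD : ∀ a b, β a ≠ β b → D a b = 0)
    (hnear : ∀ a, ∑ b, ‖(D - diagonal (ev ∘ β)) a b‖ < δ)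
    (hT : IsUnit T) (hB : B * T = T * D) :
    B ∈ normalMatricesWithMult n k ↔
      (∃ θ : Fin I → ℂ, D = diagonal (θ ∘ β)) ∧ ∀ a b, β a ≠ β b → (Tᴴ * T) a b = 0 := by
  constructor
  · rintro ⟨hBn, ν, -, hc⟩
    have hθ : ∃ θ : Fin I → ℂ, D = diagonal (θ ∘ β) := by
      -- `V` is an eigenbasis of `B`, so `T⁻¹ V` is one of `D`.
      obtain ⟨V, hV, μ, hBV⟩ := exists_unitary_diagonal_of_mem_normalMatrices hBn
      obtain ⟨T', rfl⟩ := hT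
      have hVu : IsUnit V := ⟨⟨V, Vᴴ, unitaryGroup_mul_conjTranspose hV,
        unitaryGroup_conjTranspose_mul hV⟩, rfl⟩
      refine exists_eq_diagonal_of_near (G := T'⁻¹.val * V) (μ := μ) (ν := ν) hβ hD hnear hsep
        (T'⁻¹.isUnit.mul hVu) ?_ ?_
      · have h1 : D = T'⁻¹.val * B * T'.val := by
          rw [Matrix.mul_assoc, hB, ← Matrix.mul_assoc, Units.inv_mul, Matrix.one_mul]
        have h2 : B * V = V * diagonal μ := by
          rw [hBV, Matrix.mul_assoc, unitaryGroup_conjTranspose_mul hV, Matrix.mul_one]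
        calc D * (T'⁻¹.val * V) = T'⁻¹.val * B * (T'.val * T'⁻¹.val) * V := by
              rw [h1]; simp only [Matrix.mul_assoc]
          _ = T'⁻¹.val * (B * V) := by
              rw [Units.mul_inv, Matrix.mul_one, Matrix.mul_assoc]
          _ = _ := by rw [h2, Matrix.mul_assoc]
      · intro c
        apply isRoot_prod_iff (k := k)
        rw [← hc, hBV, charpoly_unitary_conj hV]
        exact diagonal_eval_charpoly c
    refine ⟨hθ, ?_⟩
    obtain ⟨θ, rfl⟩ := hθ
    intro a b hab
    refine (mem_normalMatrices_iff_of_mul_eq hT hB).1 hBn a b ?_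
    exact fun h => hab (injective_of_near hsep (norm_sub_lt_of_near hβ hnear) h)
  · rintro ⟨⟨θ, rfl⟩, hTT⟩
    refine ⟨(mem_normalMatrices_iff_of_mul_eq hT hB).2 fun a b hab =>
      hTT a b fun h => hab (congrArg θ h), θ,
      injective_of_near hsep (norm_sub_lt_of_near hβ hnear), ?_⟩
    rw [charpoly_eq_of_mul_eq hT hB, charpoly_diagonal_comp hcard]

theorem unitaryOrbit_subset_normalMatricesWithMult
    (hcard : ∀ i, (Finset.univ.filter fun a => β a = i).card = k i)
    (hev : Function.Injective ev) :
    unitaryOrbit (diagonal (ev ∘ β)) ⊆ normalMatricesWithMult n k := by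
  intro A hA
  obtain ⟨h1, h2⟩ := mem_unitaryOrbit_diagonal_iff.1 hA
  exact ⟨h1, ev, hev, h2.trans (charpoly_diagonal_comp hcard ev)⟩

/-- The analogue of `mem_normalMatricesWithMult_iff_of_near` for a unitary orbit. -/
theorem mem_unitaryOrbit_iff_of_near (hβ : Function.Surjective β)
    (hcard : ∀ i, (Finset.univ.filter fun a => β a = i).card = k i) (hev : Function.Injective ev)
    (hsep : ∀ i j, i ≠ j → 2 * δ ≤ ‖ev i - ev j‖)
    (hD : ∀ a b, β a ≠ β b → D a b = 0)
    (hnear : ∀ a, ∑ b, ‖(D - diagonal (ev ∘ β)) a b‖ < δ)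
    (hT : IsUnit T) (hB : B * T = T * D) :
    B ∈ unitaryOrbit (diagonal (ev ∘ β)) ↔
      D = diagonal (ev ∘ β) ∧ ∀ a b, β a ≠ β b → (Tᴴ * T) a b = 0 := by
  constructor
  · intro hBo
    obtain ⟨⟨θ, rfl⟩, h2⟩ := (mem_normalMatricesWithMult_iff_of_near hβ hcard hsep hD hnear hT
      hB).1 (unitaryOrbit_subset_normalMatricesWithMult hcard hev hBo)
    refine ⟨?_, h2⟩
    have hθ := norm_sub_lt_of_near hβ hnear
    have hc := (mem_unitaryOrbit_diagonal_iff.1 hBo).2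
    rw [charpoly_eq_of_mul_eq hT hB, charpoly_diagonal_comp hcard ev] at hc
    congr 1
    funext a
    -- The block scalar is a root of the prescribed polynomial, hence some `ev j`; being within `δ`
    -- of `ev (β a)` leaves only `j = β a`.
    obtain ⟨j, hj⟩ := isRoot_prod_iff (k := k) (hc ▸ diagonal_eval_charpoly (μ := θ ∘ β) a)
    have hpos : 0 < δ := (norm_nonneg _).trans_lt (hθ (β a))
    have h3 : j = β a := by
      refine eq_of_norm_sub_lt hsep (z := (θ ∘ β) a) ?_ (hθ (β a))
      rw [hj]
      simpa using hpos
    rw [hj, h3]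
    rfl
  · rintro ⟨rfl, hTT⟩
    rw [mem_unitaryOrbit_diagonal_iff]
    exact ⟨(mem_normalMatrices_iff_of_mul_eq hT hB).2 fun a b hab =>
      hTT a b fun h => hab (congrArg ev h), charpoly_eq_of_mul_eq hT hB⟩

end BlockDiagonal

-- Local coordinates and the linear model

section LocalModel

open Matrix Filter Topology Module

variable {n I : ℕ}

/-- The off-diagonal part of a matrix with respect to a block structure. -/
noncomputable def offBlock (β : Fin n → Fin I) :
    Matrix (Fin n) (Fin n) ℂ →L[ℝ] Matrix (Fin n) (Fin n) ℂ :=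
  LinearMap.toContinuousLinearMap
    { toFun := fun Z => of fun a b => if β a = β b then 0 else Z a b
      map_add' := fun Z W => by ext a b; simp only [of_apply, Matrix.add_apply]; split_ifs <;> simp
      map_smul' := fun c Z => by ext a b; simp }

theorem offBlock_apply (β : Fin n → Fin I) (Z : Matrix (Fin n) (Fin n) ℂ) (a b : Fin n) :
    offBlock β Z a b = if β a = β b then 0 else Z a b := rfl

/-- Entrywise multiplication by nonzero scalars. -/
noncomputable def entrywiseMul (c : Fin n → Fin n → ℂ) (hc : ∀ a b, c a b ≠ 0) :
    Matrix (Fin n) (Fin n) ℂ ≃L[ℝ] Matrix (Fin n) (Fin n) ℂ :=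
  LinearEquiv.toContinuousLinearEquiv
    { toFun := fun Z => of fun a b => c a b * Z a b
      invFun := fun Z => of fun a b => (c a b)⁻¹ * Z a b
      map_add' := fun Z W => by ext a b; simp [mul_add]
      map_smul' := fun r Z => by ext a b; simp [mul_left_comm]
      left_inv := fun Z => by ext a b; simp [hc a b]
      right_inv := fun Z => by ext a b; simp [hc a b] }

theorem entrywiseMul_apply (c : Fin n → Fin n → ℂ) (hc : ∀ a b, c a b ≠ 0)
    (Z : Matrix (Fin n) (Fin n) ℂ) (a b : Fin n) :
    entrywiseMul c hc Z a b = c a b * Z a b := rfl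

/-- Conjugation by a unitary matrix. -/
noncomputable def unitaryConj (U : Matrix (Fin n) (Fin n) ℂ) (hU : U ∈ unitaryGroup (Fin n) ℂ) :
    Matrix (Fin n) (Fin n) ℂ ≃L[ℝ] Matrix (Fin n) (Fin n) ℂ :=
  LinearEquiv.toContinuousLinearEquiv
    { toFun := fun Z => U * Z * Uᴴ
      invFun := fun Z => Uᴴ * Z * U
      map_add' := fun Z W => by simp [Matrix.mul_add, Matrix.add_mul]
      map_smul' := fun r Z => by simp
      left_inv := fun Z => ((conj_eq_iff hU).1 rfl).symm
      right_inv := fun Z => (conj_eq_iff hU).2 rfl }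

/-- Local coordinates near `Λ`: block diagonal perturbations of `Λ`, conjugated by `1 + K` with `K`
off-diagonal. -/
noncomputable def blockCoord (β : Fin n → Fin I) (Λ Z : Matrix (Fin n) (Fin n) ℂ) :
    Matrix (Fin n) (Fin n) ℂ :=
  (1 + offBlock β Z) * (Λ + (Z - offBlock β Z)) * Ring.inverse (1 + offBlock β Z)

/-- With `K = offBlock β Z`, the derivative is `(Z - K) + (K Λ - Λ K)`: the identity within blocks,
multiplication by `ev (β b) - ev (β a)` off them. -/
theorem hasFDerivAt_blockCoord (β : Fin n → Fin I) {ev : Fin I → ℂ} (hev : Function.Injective ev) :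
    ∃ e : Matrix (Fin n) (Fin n) ℂ ≃L[ℝ] Matrix (Fin n) (Fin n) ℂ,
      HasFDerivAt (blockCoord β (diagonal (ev ∘ β)))
        (e : Matrix (Fin n) (Fin n) ℂ →L[ℝ] Matrix (Fin n) (Fin n) ℂ) 0 := by
  have hc : ∀ a b, (if β a = β b then 1 else ev (β b) - ev (β a)) ≠ 0 := by
    intro a b
    split_ifs with h
    · exact one_ne_zero
    · exact sub_ne_zero.2 fun h' => h (hev h').symm
  refine ⟨entrywiseMul _ hc, ?_⟩
  set Λ := diagonal (ev ∘ β) with hΛ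
  have h1 : HasFDerivAt (fun Z => 1 + offBlock β Z) (offBlock β) 0 :=
    (offBlock β).hasFDerivAt.const_add 1
  have h2 : HasFDerivAt (fun Z => Λ + (Z - offBlock β Z))
      (ContinuousLinearMap.id ℝ _ - offBlock β) 0 :=
    ((hasFDerivAt_id 0).sub (offBlock β).hasFDerivAt).const_add Λ
  have h3 : HasFDerivAt (fun Z => Ring.inverse (1 + offBlock β Z)) (-offBlock β) 0 := by
    have h4 := hasFDerivAt_ringInverse (𝕜 := ℝ) (1 : (Matrix (Fin n) (Fin n) ℂ)ˣ)
    have h5 : ((1 : (Matrix (Fin n) (Fin n) ℂ)ˣ) : Matrix (Fin n) (Fin n) ℂ) =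
        1 + offBlock β 0 := by simp
    rw [h5] at h4
    refine (h4.comp (0 : Matrix (Fin n) (Fin n) ℂ) h1).congr_fderiv ?_
    ext1 Z
    change -((((1 : (Matrix (Fin n) (Fin n) ℂ)ˣ)⁻¹ : (Matrix (Fin n) (Fin n) ℂ)ˣ) :
      Matrix (Fin n) (Fin n) ℂ) * offBlock β Z *
      (((1 : (Matrix (Fin n) (Fin n) ℂ)ˣ)⁻¹ : (Matrix (Fin n) (Fin n) ℂ)ˣ) :
      Matrix (Fin n) (Fin n) ℂ)) = -offBlock β Z
    simp
  refine ((h1.mul' h2).mul' h3).congr_fderiv ?_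
  ext1 Z
  change ((1 + offBlock β 0) * (Λ + (0 - offBlock β 0))) * (-offBlock β Z) +
    ((1 + offBlock β 0) * (Z - offBlock β Z) + offBlock β Z * (Λ + (0 - offBlock β 0))) *
      Ring.inverse (1 + offBlock β 0) = entrywiseMul _ hc Z
  ext a b
  rw [entrywiseMul_apply]
  simp [offBlock_apply, hΛ]
  split_ifs with h
  · simp
  · ring

theorem eventually_isUnit_one_add_offBlock (β : Fin n → Fin I) :
    ∀ᶠ Z in 𝓝 (0 : Matrix (Fin n) (Fin n) ℂ), IsUnit (1 + offBlock β Z) := by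
  have h1 : ContinuousAt (fun Z => 1 + offBlock β Z) 0 := by fun_prop
  refine h1.eventually (p := IsUnit) ?_
  simp only [map_zero, add_zero]
  exact Units.nhds (1 : (Matrix (Fin n) (Fin n) ℂ)ˣ)

theorem contDiffAt_blockCoord (β : Fin n → Fin I) (Λ : Matrix (Fin n) (Fin n) ℂ) :
    ∀ᶠ Z in 𝓝 (0 : Matrix (Fin n) (Fin n) ℂ), ContDiffAt ℝ ∞ (blockCoord β Λ) Z := by
  filter_upwards [eventually_isUnit_one_add_offBlock β] with Z hZ
  obtain ⟨u, hu⟩ := hZ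
  have h1 : ContDiffAt ℝ ∞ (fun Z => 1 + offBlock β Z) Z := by fun_prop
  have h2 : ContDiffAt ℝ ∞ (fun Z => Λ + (Z - offBlock β Z)) Z := by fun_prop
  have h3 : ContDiffAt ℝ ∞ (fun Z => Ring.inverse (1 + offBlock β Z)) Z := by
    have h4 := contDiffAt_ringInverse (n := ∞) ℝ u
    rw [hu] at h4
    exact h4.comp Z h1
  exact (h1.mul h2).mul h3

/-- The map that straightens the condition that the blocks of columns of `1 + K` are orthogonal. -/
noncomputable def straighten (β : Fin n → Fin I) (Z : Matrix (Fin n) (Fin n) ℂ) :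
    Matrix (Fin n) (Fin n) ℂ :=
  Z + (1 / 2 : ℝ) • offBlock β ((offBlock β Z)ᴴ * offBlock β Z)

theorem contDiff_straighten (β : Fin n → Fin I) : ContDiff ℝ ∞ (straighten β) := by
  have h1 : ContDiff ℝ ∞ (fun Z => (offBlock β Z)ᴴ) :=
    (starL' ℝ : Matrix (Fin n) (Fin n) ℂ ≃L[ℝ] Matrix (Fin n) (Fin n) ℂ).contDiff.comp
      (offBlock β).contDiff
  have h2 : ContDiff ℝ ∞ (fun Z => (offBlock β Z)ᴴ * offBlock β Z) := h1.mul (offBlock β).contDiff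
  exact contDiff_id.add (((offBlock β).contDiff.comp h2).const_smul _)

/-- The correction term is quadratic, so it vanishes to first order. -/
theorem hasFDerivAt_straighten (β : Fin n → Fin I) :
    HasFDerivAt (straighten β)
      ((ContinuousLinearEquiv.refl ℝ (Matrix (Fin n) (Fin n) ℂ) :
        Matrix (Fin n) (Fin n) ℂ →L[ℝ] Matrix (Fin n) (Fin n) ℂ)) 0 := by
  have h1 : HasFDerivAt (fun Z => (offBlock β Z)ᴴ)
      (((starL' ℝ : Matrix (Fin n) (Fin n) ℂ ≃L[ℝ] Matrix (Fin n) (Fin n) ℂ) :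
        Matrix (Fin n) (Fin n) ℂ →L[ℝ] Matrix (Fin n) (Fin n) ℂ).comp (offBlock β)) 0 :=
    ((starL' ℝ : Matrix (Fin n) (Fin n) ℂ ≃L[ℝ] Matrix (Fin n) (Fin n) ℂ) :
        Matrix (Fin n) (Fin n) ℂ →L[ℝ] Matrix (Fin n) (Fin n) ℂ).hasFDerivAt.comp 0
      (offBlock β).hasFDerivAt
  have h2 := h1.mul' (offBlock β).hasFDerivAt
  have h3 := ((hasFDerivAt_id 0).add
    (((offBlock β).hasFDerivAt.comp 0 h2).const_smul (1 / 2 : ℝ)))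
  refine h3.congr_fderiv ?_
  ext1 Z
  change Z + (1 / 2 : ℝ) • offBlock β ((offBlock β 0)ᴴ * offBlock β Z +
    (offBlock β Z)ᴴ * offBlock β 0) = Z
  simp

variable {β : Fin n → Fin I}

/-- The matrix that is block scalar with values `x.1` on the diagonal blocks, and skew-Hermitian
with entries `x.2` above the diagonal blocks. -/
noncomputable def tangentMatrix (β : Fin n → Fin I)
    (x : (Fin I → ℂ) × ({p : Fin n × Fin n // β p.1 < β p.2} → ℂ)) : Matrix (Fin n) (Fin n) ℂ :=
  fun a b => if h : β a < β b then x.2 ⟨(a, b), h⟩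
    else if h : β b < β a then -star (x.2 ⟨(b, a), h⟩)
    else if a = b then x.1 (β a) else 0

/-- `tangentMatrix` as a linear map. -/
noncomputable def tangentParam (β : Fin n → Fin I) :
    ((Fin I → ℂ) × ({p : Fin n × Fin n // β p.1 < β p.2} → ℂ)) →ₗ[ℝ]
      Matrix (Fin n) (Fin n) ℂ where
  toFun := tangentMatrix β
  map_add' x y := by
    ext a b
    rw [Matrix.add_apply]
    unfold tangentMatrix
    split_ifs
    · rfl
    · rw [Prod.snd_add, Pi.add_apply, star_add, neg_add]
    · rfl
    · rw [add_zero]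
  map_smul' r x := by
    ext a b
    rw [Matrix.smul_apply]
    unfold tangentMatrix
    split_ifs
    · rfl
    · simp
    · rfl
    · simp

theorem tangentParam_apply (x : (Fin I → ℂ) × ({p : Fin n × Fin n // β p.1 < β p.2} → ℂ))
    (a b : Fin n) : tangentParam β x a b =
      if h : β a < β b then x.2 ⟨(a, b), h⟩
      else if h : β b < β a then -star (x.2 ⟨(b, a), h⟩)
      else if a = b then x.1 (β a) else 0 := rfl

/-- Keeping `h` explicit serves both models: `h` is free for the stratum and zero for the orbit. -/
theorem tangentParam_eq_iff {h : Fin I → ℂ} {W : Matrix (Fin n) (Fin n) ℂ} :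
    (∃ c, tangentParam β (h, c) = W) ↔
      (∀ a b, β a = β b → W a b = if a = b then h (β a) else 0) ∧
        ∀ a b, β a ≠ β b → W a b + star (W b a) = 0 := by
  constructor
  · rintro ⟨c, rfl⟩
    constructor
    · intro a b hab
      simp [tangentParam_apply, hab]
    · intro a b hab
      rcases lt_or_gt_of_ne hab with h1 | h1 <;>
        simp [tangentParam_apply, h1, not_lt_of_gt h1]
  · rintro ⟨h1, h2⟩
    refine ⟨fun p => W p.1.1 p.1.2, ?_⟩
    ext a b
    rw [tangentParam_apply]
    split_ifs with h3 h4 h5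
    · rfl
    · have := h2 a b h4.ne'
      exact (eq_neg_of_add_eq_zero_left this).symm
    · rw [h1 a b (congrArg β h5), if_pos h5]
    · rw [h1 a b (le_antisymm (not_lt.1 h4) (not_lt.1 h3)), if_neg h5]

theorem tangentParam_injective (hβ : Function.Surjective β) :
    Function.Injective (tangentParam β) := by
  rw [← LinearMap.ker_eq_bot, LinearMap.ker_eq_bot']
  rintro ⟨h, c⟩ hx
  have hx' : ∀ a b, tangentParam β (h, c) a b = 0 := fun a b => by rw [hx]; rfl
  ext1
  · funext i
    obtain ⟨a, rfl⟩ := hβ i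
    simpa [tangentParam_apply] using hx' a a
  · funext ⟨⟨a, b⟩, hab⟩
    simpa [tangentParam_apply, hab] using hx' a b

/-- Pairs in a common block number `∑ kᵢ²`; swapping coordinates halves the remaining pairs. -/
theorem two_mul_card_lt_add (β : Fin n → Fin I) :
    2 * Fintype.card {p : Fin n × Fin n // β p.1 < β p.2} +
      ∑ i, (Finset.univ.filter fun a => β a = i).card ^ 2 = n ^ 2 := by
  have heq : (Finset.univ.filter fun p : Fin n × Fin n => β p.1 = β p.2).card =
      ∑ i, (Finset.univ.filter fun a => β a = i).card ^ 2 := by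
    rw [Finset.card_eq_sum_card_fiberwise (f := fun p => β p.1) (t := Finset.univ)
      (fun _ _ => Finset.mem_coe.2 (Finset.mem_univ _))]
    refine Finset.sum_congr rfl fun i _ => ?_
    rw [sq, ← Finset.card_product]
    congr 1
    ext p
    simp only [Finset.mem_filter, Finset.mem_univ, true_and, Finset.mem_product]
    constructor
    · rintro ⟨h1, h2⟩
      exact ⟨h2, h1 ▸ h2⟩
    · rintro ⟨h1, h2⟩
      exact ⟨h1.trans h2.symm, h1⟩
  have hgt : (Finset.univ.filter fun p : Fin n × Fin n => β p.2 < β p.1).card =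
      (Finset.univ.filter fun p : Fin n × Fin n => β p.1 < β p.2).card := by
    refine Finset.card_bij (fun p _ => p.swap) ?_ ?_ ?_
    · intro p hp
      simpa using hp
    · intro p _ q _ h
      exact Prod.swap_injective h
    · intro p hp
      exact ⟨p.swap, by simpa using hp, Prod.swap_swap p⟩
  have h1 := Finset.card_filter_add_card_filter_not (s := (Finset.univ : Finset (Fin n × Fin n)))
    (fun p => β p.1 = β p.2)
  have h2 := Finset.card_filter_add_card_filter_not
    (s := (Finset.univ.filter fun p : Fin n × Fin n => ¬ β p.1 = β p.2)) (fun p => β p.1 < β p.2)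
  rw [Finset.filter_filter, Finset.filter_filter] at h2
  have h3 : (Finset.univ.filter fun p : Fin n × Fin n => ¬ β p.1 = β p.2 ∧ β p.1 < β p.2) =
      Finset.univ.filter fun p : Fin n × Fin n => β p.1 < β p.2 := by
    refine Finset.filter_congr fun p _ => ?_
    constructor
    · exact fun h => h.2
    · exact fun h => ⟨h.ne, h⟩
  have h4 : (Finset.univ.filter fun p : Fin n × Fin n => ¬ β p.1 = β p.2 ∧ ¬ β p.1 < β p.2) =
      Finset.univ.filter fun p : Fin n × Fin n => β p.2 < β p.1 := by
    refine Finset.filter_congr fun p _ => ?_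
    constructor
    · exact fun h => lt_of_le_of_ne (not_lt.1 h.2) (Ne.symm h.1)
    · exact fun h => ⟨h.ne', not_lt_of_gt h⟩
  rw [h3, h4, hgt] at h2
  rw [Fintype.card_subtype, ← heq]
  have h5 : (Finset.univ : Finset (Fin n × Fin n)).card = n ^ 2 := by
    simp [sq]
  omega

theorem finrank_complex_fun (ι : Type*) [Fintype ι] : finrank ℝ (ι → ℂ) = 2 * Fintype.card ι := by
  rw [Module.finrank_pi_fintype]
  simp [Complex.finrank_real_complex, mul_comm]

theorem finrank_range_tangentParam (hβ : Function.Surjective β) :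
    finrank ℝ (LinearMap.range (tangentParam β)) =
      2 * I + 2 * Fintype.card {p : Fin n × Fin n // β p.1 < β p.2} := by
  rw [LinearMap.finrank_range_of_inj (tangentParam_injective hβ), Module.finrank_prod,
    finrank_complex_fun, finrank_complex_fun, Fintype.card_fin]

theorem finrank_range_tangentParam_inr (hβ : Function.Surjective β) :
    finrank ℝ (LinearMap.range (tangentParam β ∘ₗ LinearMap.inr ℝ _ _)) =
      2 * Fintype.card {p : Fin n × Fin n // β p.1 < β p.2} := by
  rw [LinearMap.finrank_range_of_inj (f := tangentParam β ∘ₗ LinearMap.inr ℝ _ _)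
    ((tangentParam_injective hβ).comp LinearMap.inr_injective), finrank_complex_fun]

/-- Off the blocks the Gram entry is `Z a b + star (Z b a) + N a b` with `N = Kᴴ K`. As `N` is
Hermitian, adding `N / 2` to `Z` contributes exactly `N` to the symmetrized sum; hence the factor `1
/ 2`. -/
theorem orthogonal_iff_straighten (β : Fin n → Fin I) (Z : Matrix (Fin n) (Fin n) ℂ) :
    (∀ a b, β a ≠ β b → ((1 + offBlock β Z)ᴴ * (1 + offBlock β Z) : Matrix (Fin n) (Fin n) ℂ) a b = 0) ↔
      ∀ a b, β a ≠ β b → straighten β Z a b + star (straighten β Z b a) = 0 := by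
  refine forall_congr' fun a => forall_congr' fun b => forall_congr' fun hab => ?_
  have hab' : a ≠ b := fun h => hab (congrArg β h)
  set N := (offBlock β Z)ᴴ * offBlock β Z with hN
  have hNH : star (N b a) = N a b := by
    have : Nᴴ = N := by simp [hN]
    exact congrFun (congrFun this a) b
  have h1 : ((1 + offBlock β Z)ᴴ * (1 + offBlock β Z) : Matrix (Fin n) (Fin n) ℂ) a b = Z a b + star (Z b a) + N a b := by
    have : (1 + offBlock β Z)ᴴ * (1 + offBlock β Z) =
        1 + offBlock β Z + (offBlock β Z)ᴴ + N := by
      rw [hN, conjTranspose_add, conjTranspose_one]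
      noncomm_ring
    rw [this]
    simp [offBlock_apply, hab, Ne.symm hab, hab']
  have h2 : straighten β Z a b + star (straighten β Z b a) = Z a b + star (Z b a) + N a b := by
    have h3 : straighten β Z a b = Z a b + N a b / 2 := by
      simp [straighten, offBlock_apply, hab, ← hN, div_eq_inv_mul]
    have h4 : straighten β Z b a = Z b a + N b a / 2 := by
      simp [straighten, offBlock_apply, Ne.symm hab, ← hN, div_eq_inv_mul]
    have h5 : star (N b a / 2) = N a b / 2 := by
      rw [star_div₀, hNH]
      simp
    rw [h3, h4, star_add, h5]
    ring
  rw [h1, h2]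

theorem straighten_apply_of_eq {Z : Matrix (Fin n) (Fin n) ℂ} {a b : Fin n} (h : β a = β b) :
    straighten β Z a b = Z a b := by
  simp [straighten, offBlock_apply, h]

theorem add_sub_offBlock_eq_diagonal_iff {ev θ : Fin I → ℂ} {Z : Matrix (Fin n) (Fin n) ℂ} :
    diagonal (ev ∘ β) + (Z - offBlock β Z) = diagonal (θ ∘ β) ↔
      ∀ a b, β a = β b → straighten β Z a b = if a = b then (θ - ev) (β a) else 0 := by
  rw [← Matrix.ext_iff]
  refine forall_congr' fun a => forall_congr' fun b => ?_
  by_cases h : β a = β b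
  · rw [straighten_apply_of_eq h]
    by_cases hab : a = b
    · subst hab
      simp [offBlock_apply, eq_sub_iff_add_eq, add_comm]
    · simp [offBlock_apply, h, hab]
  · have hab : a ≠ b := fun h' => h (congrArg β h')
    simp [offBlock_apply, h, hab]

theorem exists_separation {ev : Fin I → ℂ} (hev : Function.Injective ev) :
    ∃ δ > 0, ∀ i j, i ≠ j → 2 * δ ≤ ‖ev i - ev j‖ := by
  have h : ∀ i j, ∃ r > 0, ∀ s ≤ r, i ≠ j → 2 * s ≤ ‖ev i - ev j‖ := by
    intro i j
    by_cases hij : i = j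
    · exact ⟨1, one_pos, fun _ _ h => absurd hij h⟩
    · refine ⟨‖ev i - ev j‖ / 2, half_pos (norm_pos_iff.2 (sub_ne_zero.2 (hev.ne hij))), ?_⟩
      intro s hs _
      linarith
  choose r hr hr' using h
  -- Taking any small positive `s` avoids a minimum over a possibly empty index set.
  have h2 : ∀ᶠ s in 𝓝[>] (0 : ℝ), ∀ i j, s ≤ r i j := by
    rw [eventually_all]
    intro i
    rw [eventually_all]
    intro j
    exact eventually_nhdsWithin_of_eventually_nhds (Iic_mem_nhds (hr i j))
  obtain ⟨δ, hδ, hδ0⟩ := (h2.and self_mem_nhdsWithin).exists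
  exact ⟨δ, hδ0, fun i j hij => hr' i j δ (hδ i j) hij⟩

theorem eventually_near (β : Fin n → Fin I) (Λ : Matrix (Fin n) (Fin n) ℂ) {δ : ℝ} (hδ : 0 < δ) :
    ∀ᶠ Z in 𝓝 (0 : Matrix (Fin n) (Fin n) ℂ),
      ∀ a, ∑ b, ‖(Λ + (Z - offBlock β Z) - Λ) a b‖ < δ := by
  rw [eventually_all]
  intro a
  have h1 : ContinuousAt (fun Z : Matrix (Fin n) (Fin n) ℂ =>
      ∑ b, ‖(Λ + (Z - offBlock β Z) - Λ) a b‖) 0 := by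
    have h2 : ∀ b, Continuous fun Z : Matrix (Fin n) (Fin n) ℂ =>
        (Λ + (Z - offBlock β Z) - Λ) a b := by
      intro b
      have h3 : Continuous fun Z => Λ + (Z - offBlock β Z) - Λ := by fun_prop
      exact h3.matrix_elem a b
    exact (continuous_finsetSum _ fun b _ => (h2 b).norm).continuousAt
  apply h1.eventually_lt_const
  simpa using hδ

theorem blockCoord_mul (Λ : Matrix (Fin n) (Fin n) ℂ) {Z : Matrix (Fin n) (Fin n) ℂ}
    (h : IsUnit (1 + offBlock β Z)) :
    blockCoord β Λ Z * (1 + offBlock β Z) = (1 + offBlock β Z) * (Λ + (Z - offBlock β Z)) := by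
  rw [blockCoord, Matrix.mul_assoc]
  erw [Ring.inverse_mul_cancel _ h]
  rw [Matrix.mul_one]

variable {k : Fin I → ℕ} {ev : Fin I → ℂ}

theorem eventually_blockCoord_mem_normalMatricesWithMult (hβ : Function.Surjective β)
    (hcard : ∀ i, (Finset.univ.filter fun a => β a = i).card = k i) (hev : Function.Injective ev) :
    ∀ᶠ Z in 𝓝 (0 : Matrix (Fin n) (Fin n) ℂ),
      (blockCoord β (diagonal (ev ∘ β)) Z ∈ normalMatricesWithMult n k ↔
        straighten β Z ∈ LinearMap.range (tangentParam β)) := by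
  obtain ⟨δ, hδ, hsep⟩ := exists_separation hev
  filter_upwards [eventually_near β (diagonal (ev ∘ β)) hδ,
    eventually_isUnit_one_add_offBlock β] with Z hnear hT
  have hD : ∀ a b, β a ≠ β b → (diagonal (ev ∘ β) + (Z - offBlock β Z)) a b = 0 := by
    intro a b hab
    have hab' : a ≠ b := fun h => hab (congrArg β h)
    simp [offBlock_apply, hab, hab']
  rw [mem_normalMatricesWithMult_iff_of_near hβ hcard hsep hD hnear hT (blockCoord_mul _ hT),
    orthogonal_iff_straighten]
  simp only [add_sub_offBlock_eq_diagonal_iff]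
  constructor
  · rintro ⟨⟨θ, h1⟩, h2⟩
    obtain ⟨c, hc⟩ := tangentParam_eq_iff.2 ⟨h1, h2⟩
    exact ⟨_, hc⟩
  · rintro ⟨⟨h, c⟩, hc⟩
    obtain ⟨h1, h2⟩ := tangentParam_eq_iff.1 ⟨c, hc⟩
    -- The parameter `h` is the displacement of the eigenvalues from `ev`.
    refine ⟨⟨h + ev, ?_⟩, h2⟩
    simpa using h1

theorem eventually_blockCoord_mem_unitaryOrbit (hβ : Function.Surjective β)
    (hcard : ∀ i, (Finset.univ.filter fun a => β a = i).card = k i) (hev : Function.Injective ev) :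
    ∀ᶠ Z in 𝓝 (0 : Matrix (Fin n) (Fin n) ℂ),
      (blockCoord β (diagonal (ev ∘ β)) Z ∈ unitaryOrbit (diagonal (ev ∘ β)) ↔
        straighten β Z ∈ LinearMap.range (tangentParam β ∘ₗ LinearMap.inr ℝ _ _)) := by
  obtain ⟨δ, hδ, hsep⟩ := exists_separation hev
  filter_upwards [eventually_near β (diagonal (ev ∘ β)) hδ,
    eventually_isUnit_one_add_offBlock β] with Z hnear hT
  have hD : ∀ a b, β a ≠ β b → (diagonal (ev ∘ β) + (Z - offBlock β Z)) a b = 0 := by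
    intro a b hab
    have hab' : a ≠ b := fun h => hab (congrArg β h)
    simp [offBlock_apply, hab, hab']
  rw [mem_unitaryOrbit_iff_of_near hβ hcard hev hsep hD hnear hT (blockCoord_mul _ hT),
    orthogonal_iff_straighten, add_sub_offBlock_eq_diagonal_iff, ← tangentParam_eq_iff, sub_self]
  rfl

/-- A set that is linear near `Λ` in the coordinates above has a submanifold chart at `Λ`. -/
theorem hasSubmanifoldChart_diagonal {S : Set (Matrix (Fin n) (Fin n) ℂ)}
    {L : Submodule ℝ (Matrix (Fin n) (Fin n) ℂ)} (hev : Function.Injective ev)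
    (h : ∀ᶠ Z in 𝓝 (0 : Matrix (Fin n) (Fin n) ℂ),
      (blockCoord β (diagonal (ev ∘ β)) Z ∈ S ↔ straighten β Z ∈ L)) :
    HasSubmanifoldChart (finrank ℝ L) S (diagonal (ev ∘ β)) := by
  obtain ⟨e, he⟩ := hasFDerivAt_blockCoord β hev
  have h0 : blockCoord β (diagonal (ev ∘ β)) 0 = diagonal (ev ∘ β) := by
    simp [blockCoord]
  have h3 : ∀ᶠ Z in 𝓝 (0 : Matrix (Fin n) (Fin n) ℂ), ContDiffAt ℝ ∞ (straighten β) Z :=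
    Eventually.of_forall fun Z => (contDiff_straighten β).contDiffAt
  have h4 := hasSubmanifoldChart_of_eventually (contDiffAt_blockCoord β (diagonal (ev ∘ β))) he h3
    (hasFDerivAt_straighten β) h
  rwa [h0] at h4

/-- A set that is invariant under unitary conjugation has submanifold charts on the orbit of `Λ` if
it is linear near `Λ` in the coordinates above. -/
theorem hasSubmanifoldChart_conj {S : Set (Matrix (Fin n) (Fin n) ℂ)}
    {L : Submodule ℝ (Matrix (Fin n) (Fin n) ℂ)} {U : Matrix (Fin n) (Fin n) ℂ}
    (hU : U ∈ unitaryGroup (Fin n) ℂ) (hS : ∀ A, U * A * Uᴴ ∈ S ↔ A ∈ S)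
    (hev : Function.Injective ev)
    (h : ∀ᶠ Z in 𝓝 (0 : Matrix (Fin n) (Fin n) ℂ),
      (blockCoord β (diagonal (ev ∘ β)) Z ∈ S ↔ straighten β Z ∈ L)) :
    HasSubmanifoldChart (finrank ℝ L) S (U * diagonal (ev ∘ β) * Uᴴ) :=
  (hasSubmanifoldChart_diagonal hev h).map (unitaryConj U hU) hS

end LocalModel

-- Strata, their dimensions and the covering of the normal matrices

section Dimension

open Matrix Module

variable {n I : ℕ} {k : Fin I → ℕ} {β : Fin n → Fin I} {ev : Fin I → ℂ}

theorem exists_blocks (hsum : ∑ i, k i = n) :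
    ∃ β : Fin n → Fin I, ∀ i, (Finset.univ.filter fun a => β a = i).card = k i := by
  subst hsum
  refine ⟨fun a => (finSigmaFinEquiv.symm a).1, fun i => ?_⟩
  rw [← Fintype.card_subtype, ← Fintype.card_fin (k i)]
  refine Fintype.card_congr ((finSigmaFinEquiv.symm.subtypeEquiv (q := fun s => s.1 = i)
    fun a => Iff.rfl).trans (Equiv.sigmaSubtype (β := fun i => Fin (k i)) i))

theorem surjective_of_card_fiber (hk : ∀ i, 1 ≤ k i)
    (hcard : ∀ i, (Finset.univ.filter fun a => β a = i).card = k i) : Function.Surjective β := by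
  intro i
  have h : 0 < (Finset.univ.filter fun a => β a = i).card := by
    rw [hcard]
    exact hk i
  obtain ⟨a, ha⟩ := Finset.card_pos.1 h
  exact ⟨a, by simpa using ha⟩

theorem self_mem_unitaryOrbit (Λ : Matrix (Fin n) (Fin n) ℂ) : Λ ∈ unitaryOrbit Λ :=
  ⟨1, one_mem _, by simp⟩

theorem isSmoothSubmanifold_unitaryOrbit (hβ : Function.Surjective β)
    (hcard : ∀ i, (Finset.univ.filter fun a => β a = i).card = k i) (hev : Function.Injective ev) :
    IsSmoothSubmanifold (2 * Fintype.card {p : Fin n × Fin n // β p.1 < β p.2})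
      (unitaryOrbit (diagonal (ev ∘ β))) := by
  rintro A ⟨U, hU, rfl⟩
  have h := hasSubmanifoldChart_conj hU (fun A => conj_mem_unitaryOrbit hU) hev
    (eventually_blockCoord_mem_unitaryOrbit hβ hcard hev)
  rwa [finrank_range_tangentParam_inr hβ] at h

/-- One fixed `β` suffices for the whole stratum, since reordering a diagonal matrix does not change
its orbit. -/
theorem mem_normalMatricesWithMult_iff
    (hcard : ∀ i, (Finset.univ.filter fun a => β a = i).card = k i)
    {A : Matrix (Fin n) (Fin n) ℂ} :
    A ∈ normalMatricesWithMult n k ↔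
      ∃ ev : Fin I → ℂ, Function.Injective ev ∧ A ∈ unitaryOrbit (diagonal (ev ∘ β)) := by
  constructor
  · rintro ⟨h1, ev, hev, h2⟩
    exact ⟨ev, hev, mem_unitaryOrbit_diagonal_iff.2
      ⟨h1, h2.trans (charpoly_diagonal_comp hcard ev).symm⟩⟩
  · rintro ⟨ev, hev, h⟩
    exact unitaryOrbit_subset_normalMatricesWithMult hcard hev h

theorem isSmoothSubmanifold_normalMatricesWithMult (hβ : Function.Surjective β)
    (hcard : ∀ i, (Finset.univ.filter fun a => β a = i).card = k i) :
    IsSmoothSubmanifold (2 * I + 2 * Fintype.card {p : Fin n × Fin n // β p.1 < β p.2})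
      (normalMatricesWithMult n k) := by
  intro A hA
  obtain ⟨ev, hev, U, hU, rfl⟩ := (mem_normalMatricesWithMult_iff hcard).1 hA
  have h := hasSubmanifoldChart_conj hU (fun A => conj_mem_normalMatricesWithMult hU) hev
    (eventually_blockCoord_mem_normalMatricesWithMult hβ hcard hev)
  rwa [finrank_range_tangentParam hβ] at h

theorem normalMatricesWithMult_nonempty (hsum : ∑ i, k i = n) :
    (normalMatricesWithMult n k).Nonempty := by
  obtain ⟨β, hcard⟩ := exists_blocks hsum
  refine ⟨diagonal ((fun i : Fin I => ((i : ℕ) : ℂ)) ∘ β),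
    (mem_normalMatricesWithMult_iff hcard).2 ⟨_, ?_, self_mem_unitaryOrbit _⟩⟩
  exact Nat.cast_injective.comp Fin.val_injective

/-- The set of normal matrices with given multiplicities is a submanifold of known dimension. -/
theorem exists_dim_normalMatricesWithMult (hk : ∀ i, 1 ≤ k i) (hsum : ∑ i, k i = n) :
    ∃ d, IsSmoothSubmanifold d (normalMatricesWithMult n k) ∧ d + ∑ i, k i ^ 2 = n ^ 2 + 2 * I := by
  obtain ⟨β, hcard⟩ := exists_blocks hsum
  have hβ := surjective_of_card_fiber hk hcard
  refine ⟨_, isSmoothSubmanifold_normalMatricesWithMult hβ hcard, ?_⟩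
  have h := two_mul_card_lt_add β
  simp only [hcard] at h
  omega

/-- Diagonalize and group equal diagonal entries; the blocks are the fibres of `μ`. -/
theorem exists_mem_normalMatricesWithMult {A : Matrix (Fin n) (Fin n) ℂ}
    (hA : A ∈ normalMatrices n) :
    ∃ (I : ℕ) (k : Fin I → ℕ), (∀ i, 1 ≤ k i) ∧ ∑ i, k i = n ∧
      A ∈ normalMatricesWithMult n k := by
  classical
  obtain ⟨U, hU, μ, rfl⟩ := exists_unitary_diagonal_of_mem_normalMatrices hA
  set s := Finset.univ.image μ with hs
  have hμs : ∀ a, μ a ∈ s := fun a => Finset.mem_image_of_mem _ (Finset.mem_univ a)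
  set β : Fin n → Fin s.card := fun a => s.equivFin ⟨μ a, hμs a⟩ with hβ
  set ev : Fin s.card → ℂ := fun i => (s.equivFin.symm i).1 with hev
  have hμ : μ = ev ∘ β := by
    funext a
    simp [hβ, hev]
  have hevi : Function.Injective ev := Subtype.val_injective.comp s.equivFin.symm.injective
  refine ⟨s.card, fun i => (Finset.univ.filter fun a => β a = i).card, ?_, ?_, ?_⟩
  · intro i
    obtain ⟨a, -, ha⟩ := Finset.mem_image.1 (s.equivFin.symm i).2
    refine Finset.card_pos.2 ⟨a, Finset.mem_filter.2 ⟨Finset.mem_univ a, hevi ?_⟩⟩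
    rw [← Function.comp_apply (f := ev), ← hμ, ha]
  · rw [← Finset.card_eq_sum_card_fiberwise (fun _ _ => Finset.mem_coe.2 (Finset.mem_univ _))]
    simp
  · rw [conj_mem_normalMatricesWithMult hU, hμ,
      mem_normalMatricesWithMult_iff (β := β) fun i => rfl]
    exact ⟨ev, hevi, self_mem_unitaryOrbit _⟩

/-- The strata are indexed by a countable type, so the dimension of their union is the supremum of
theirs. -/
theorem dimH_normalMatrices_le (n : ℕ) : dimH (normalMatrices n) ≤ (n ^ 2 + n : ℕ) := by
  have hsub : normalMatrices n ⊆
      ⋃ p : Σ I : ℕ, {k : Fin I → ℕ // (∀ i, 1 ≤ k i) ∧ ∑ i, k i = n},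
        normalMatricesWithMult n p.2.1 := by
    intro A hA
    obtain ⟨I, k, h1, h2, h3⟩ := exists_mem_normalMatricesWithMult hA
    exact Set.mem_iUnion.2 ⟨⟨I, k, h1, h2⟩, h3⟩
  refine (dimH_mono hsub).trans ?_
  rw [dimH_iUnion]
  refine iSup_le ?_
  rintro ⟨I, k, hk, hsum⟩
  obtain ⟨d, hd, hdim⟩ := exists_dim_normalMatricesWithMult hk hsum
  change dimH (normalMatricesWithMult n k) ≤ _
  rw [hd.dimH_eq (normalMatricesWithMult_nonempty hsum)]
  have h : 2 * I ≤ n + ∑ i, k i ^ 2 := by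
    -- Each `k i ≥ 1` gives `2 ≤ k i + k i ^ 2`, with equality only for `k i = 1`.
    have h1 : ∑ _i : Fin I, 2 ≤ ∑ i, (k i + k i ^ 2) :=
      Finset.sum_le_sum fun i _ => Nat.add_le_add (hk i) (Nat.one_le_pow _ _ (hk i))
    rw [Finset.sum_add_distrib, hsum] at h1
    simpa [mul_comm] using h1
  exact_mod_cast (by omega : d ≤ n ^ 2 + n)

/-- The stratum of simple spectrum attains the upper bound. -/
theorem realDim_normalMatrices (n : ℕ) : realDim (normalMatrices n) = n ^ 2 + n := by
  have hsum : ∑ _i : Fin n, 1 = n := by simp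
  obtain ⟨d, hd, hdim⟩ := exists_dim_normalMatricesWithMult (fun _ => le_refl 1) hsum
  have h1 : d = n ^ 2 + n := by
    simp at hdim
    omega
  rw [h1] at hd
  exact realDim_eq_of_dimH_le (fun A hA => hA.1) (normalMatricesWithMult_nonempty hsum) hd
    (dimH_normalMatrices_le n)

end Dimension

-- Assembly of the four statements

theorem corollary2p2 (n I : ℕ) (k : Fin I → ℕ) (hk : ∀ i, 1 ≤ k i) (hsum : ∑ i, k i = n) :
    (∀ μ : Fin n → ℂ, HasMultiplicities k (Matrix.diagonal μ) →
      IsSmoothSubmanifold (realDim (unitaryOrbit (Matrix.diagonal μ)))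
        (unitaryOrbit (Matrix.diagonal μ)) ∧
      (realDim (unitaryOrbit (Matrix.diagonal μ)) : ℤ) = (n : ℤ) ^ 2 - ∑ i, (k i : ℤ) ^ 2) ∧
    (IsSmoothSubmanifold (realDim (normalMatricesWithMult n k)) (normalMatricesWithMult n k) ∧
      (realDim (normalMatricesWithMult n k) : ℤ) =
        (n : ℤ) ^ 2 - ∑ i, (k i : ℤ) ^ 2 + 2 * (I : ℤ)) ∧
    realDim (normalMatrices n) = n ^ 2 + n ∧
    realCodim (normalMatricesWithMult n k) (normalMatrices n) =
      (n : ℤ) + ∑ i, (k i : ℤ) ^ 2 - 2 * (I : ℤ) ∧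
    realCodim (normalMatricesWithMult n k) (normalMatrices n) =
      ∑ i, ((k i : ℤ) - 1) * ((k i : ℤ) + 2) := by
  obtain ⟨d, hd, hdim⟩ := exists_dim_normalMatricesWithMult hk hsum
  have hreal := hd.realDim_eq (normalMatricesWithMult_nonempty hsum)
  have hdimZ : (d : ℤ) + ∑ i, (k i : ℤ) ^ 2 = (n : ℤ) ^ 2 + 2 * I := by exact_mod_cast hdim
  have hcodim : realCodim (normalMatricesWithMult n k) (normalMatrices n) =
      (n : ℤ) + ∑ i, (k i : ℤ) ^ 2 - 2 * (I : ℤ) := by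
    rw [realCodim, hreal, realDim_normalMatrices]
    push_cast
    linarith
  refine ⟨?_, ⟨?_, ?_⟩, realDim_normalMatrices n, hcodim, ?_⟩
  · intro μ hμ
    obtain ⟨β, hcard⟩ := exists_blocks hsum
    have hβ := surjective_of_card_fiber hk hcard
    obtain ⟨ev, hev, hc⟩ := hμ
    -- The entries of `μ` need not be sorted according to `β`, but the orbit depends only on the
    -- characteristic polynomial.
    have horb : unitaryOrbit (Matrix.diagonal μ) = unitaryOrbit (Matrix.diagonal (ev ∘ β)) := by
      ext A
      rw [mem_unitaryOrbit_diagonal_iff, mem_unitaryOrbit_diagonal_iff, hc,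
        charpoly_diagonal_comp hcard]
    have hman := isSmoothSubmanifold_unitaryOrbit hβ hcard hev
    have hre := hman.realDim_eq ⟨_, self_mem_unitaryOrbit _⟩
    rw [horb, hre]
    refine ⟨hman, ?_⟩
    have h := two_mul_card_lt_add β
    simp only [hcard] at h
    have hZ : ((2 * Fintype.card {p : Fin n × Fin n // β p.1 < β p.2} : ℕ) : ℤ) +
        ∑ i, (k i : ℤ) ^ 2 = (n : ℤ) ^ 2 := by exact_mod_cast h
    linarith
  · rw [hreal]
    exact hd
  · rw [hreal]
    linarith
  · rw [hcodim, ← hsum]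
    have h : ∀ i, ((k i : ℤ) - 1) * ((k i : ℤ) + 2) = (k i : ℤ) + (k i : ℤ) ^ 2 - 2 := by
      intro i
      ring
    simp only [h, Finset.sum_sub_distrib, Finset.sum_add_distrib]
    simp [mul_comm]
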